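/- Let $\mathbb K=\mathbb R$ or $\mathbb C$, let $L^2(-1,1)=L^2((-1,1);\mathbb K)$, and let $c$ be a real number with $c<-\frac14$. Consider the densely defined operator $f\mapsto \partial_{xx}f-\frac{c}{x^2}f$ on $L^2(-1,1)$ with domain $C_0^\infty((-1,1)\setminus\{0\})$, the smooth $\mathbb K$-valued functions with compact support in $(-1,1)\setminus\{0\}$. Then there is no self-adjoint extension $(A,D(A))$ of this operator on $L^2(-1,1)$ that generates a $C^0$-semigroup (strongly continuous one-parameter semigroup of bounded linear operators) on $L^2(-1,1)$. -/

import Mathlib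

open MeasureTheory Filter Topology
open scoped NNReal ENNReal Distributions

noncomputable section

namespace InverseSquare

/-- The state space `L²(-1,1)` with scalars `𝕜 = ℝ` or `ℂ`. -/
abbrev L2 (𝕜 : Type*) [RCLike 𝕜] : Type _ :=
  Lp 𝕜 2 (volume.restrict (Set.Ioo (-1 : ℝ) 1))

/-- The open set `(-1,1) \ {0}`. -/
def puncturedInterval : TopologicalSpace.Opens ℝ :=
  ⟨Set.Ioo (-1 : ℝ) 1 \ {0}, isOpen_Ioo.sdiff isClosed_singleton⟩

/-- The differential expression `f'' - (c / x²) f`. -/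
def diffExpr {𝕜 : Type*} [RCLike 𝕜] (c : ℝ) (f : ℝ → 𝕜) (x : ℝ) : 𝕜 :=
  deriv (deriv f) x - (c / x ^ 2) • f x

section

variable {𝕜 : Type*} [RCLike 𝕜]

theorem memLp_test (f : 𝓓(puncturedInterval, 𝕜)) :
    MemLp f 2 (volume.restrict (Set.Ioo (-1 : ℝ) 1)) :=
  f.continuous.memLp_of_hasCompactSupport f.hasCompactSupport

theorem contDiff_test (f : 𝓓(puncturedInterval, 𝕜)) : ContDiff ℝ 2 f :=
  f.contDiff.of_le (WithTop.coe_le_coe.2 le_top)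

theorem differentiable_test (f : 𝓓(puncturedInterval, 𝕜)) : Differentiable ℝ f :=
  (contDiff_test f).differentiable (by norm_num)

theorem contDiff_deriv_test (f : 𝓓(puncturedInterval, 𝕜)) : ContDiff ℝ 1 (deriv f) :=
  ((contDiff_succ_iff_deriv (n := 1)).1 (contDiff_test f)).2.2

theorem differentiable_deriv_test (f : 𝓓(puncturedInterval, 𝕜)) :
    Differentiable ℝ (deriv f) :=
  (contDiff_deriv_test f).differentiable one_ne_zero

theorem continuous_diffExpr (c : ℝ) (f : 𝓓(puncturedInterval, 𝕜)) :
    Continuous (diffExpr c f) := by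
  refine ((contDiff_deriv_test f).continuous_deriv le_rfl).sub ?_
  rw [continuous_iff_continuousAt]
  intro x
  by_cases hx : x = 0
  · have h0 : x ∉ tsupport f := fun h => (f.tsupport_subset h).2 hx
    have h1 : (fun y => (c / y ^ 2) • f y) =ᶠ[𝓝 x] fun _ => 0 := by
      filter_upwards [notMem_tsupport_iff_eventuallyEq.1 h0] with y hy
      simp [hy]
    exact continuousAt_const.congr h1.symm
  · exact (continuousAt_const.div (continuous_pow 2).continuousAt (pow_ne_zero 2 hx)).smul
      f.continuous.continuousAt

theorem hasCompactSupport_diffExpr (c : ℝ) (f : 𝓓(puncturedInterval, 𝕜)) :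
    HasCompactSupport (diffExpr c f) :=
  f.hasCompactSupport.deriv.deriv.sub
    (f.hasCompactSupport.smul_left (f := fun y : ℝ => c / y ^ 2))

theorem memLp_diffExpr (c : ℝ) (f : 𝓓(puncturedInterval, 𝕜)) :
    MemLp (diffExpr c f) 2 (volume.restrict (Set.Ioo (-1 : ℝ) 1)) :=
  (continuous_diffExpr c f).memLp_of_hasCompactSupport (hasCompactSupport_diffExpr c f)

theorem diffExpr_add (c : ℝ) (f g : 𝓓(puncturedInterval, 𝕜)) :
    diffExpr c ⇑(f + g) = diffExpr c f + diffExpr c g := by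
  have h1 : deriv ⇑(f + g) = deriv f + deriv g := by
    funext x
    exact deriv_add (differentiable_test f x) (differentiable_test g x)
  funext x
  have h2 := deriv_add (differentiable_deriv_test f x) (differentiable_deriv_test g x)
  have h3 : (f + g) x = f x + g x := rfl
  simp only [diffExpr, h1, h2, h3, Pi.add_apply, smul_add]
  abel

theorem diffExpr_smul (c : ℝ) (a : 𝕜) (f : 𝓓(puncturedInterval, 𝕜)) :
    diffExpr c ⇑(a • f) = a • diffExpr c f := by
  have h1 : deriv ⇑(a • f) = a • deriv f := by
    funext x
    exact deriv_const_smul a (differentiable_test f x)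
  funext x
  have h2 := deriv_const_smul a (differentiable_deriv_test f x)
  have h3 : (a • f) x = a • f x := rfl
  simp only [diffExpr, h1, h2, h3, Pi.smul_apply, smul_sub, smul_comm a]

variable (𝕜) in
/-- The inclusion `C₀^∞((-1,1) \ {0}) → L²(-1,1)`. -/
def testToL2 : 𝓓(puncturedInterval, 𝕜) →ₗ[𝕜] L2 𝕜 where
  toFun f := (memLp_test f).toLp f
  map_add' f g := MemLp.toLp_add (memLp_test f) (memLp_test g)
  map_smul' a f := MemLp.toLp_const_smul a (memLp_test f)

variable (𝕜) in
theorem testToL2_injective : Function.Injective (testToL2 𝕜) := by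
  intro f g h
  have h1 : f =ᵐ[volume.restrict (Set.Ioo (-1 : ℝ) 1)] g :=
    (MemLp.toLp_eq_toLp_iff (memLp_test f) (memLp_test g)).1 h
  have h2 : Set.EqOn f g (Set.Ioo (-1 : ℝ) 1) :=
    Measure.eqOn_open_of_ae_eq h1 isOpen_Ioo f.continuous.continuousOn g.continuous.continuousOn
  ext x
  by_cases hx : x ∈ Set.Ioo (-1 : ℝ) 1
  · exact h2 hx
  · have hf : x ∉ tsupport f := fun h' => hx (f.tsupport_subset h').1
    have hg : x ∉ tsupport g := fun h' => hx (g.tsupport_subset h').1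
    rw [image_eq_zero_of_notMem_tsupport hf, image_eq_zero_of_notMem_tsupport hg]

variable (𝕜) in
/-- The map `f ↦ f'' - (c / x²) f` from `C₀^∞((-1,1) \ {0})` to `L²(-1,1)`. -/
def diffExprL2 (c : ℝ) : 𝓓(puncturedInterval, 𝕜) →ₗ[𝕜] L2 𝕜 where
  toFun f := (memLp_diffExpr c f).toLp (diffExpr c f)
  map_add' f g := by
    rw [← MemLp.toLp_add]
    exact MemLp.toLp_congr _ _ (.of_eq (diffExpr_add c f g))
  map_smul' a f := by
    rw [RingHom.id_apply, ← MemLp.toLp_const_smul]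
    exact MemLp.toLp_congr _ _ (.of_eq (diffExpr_smul c a f))

variable (𝕜) in
/-- The unbounded operator `∂ₓₓ - (c / x²) Id` on `L²(-1,1)` with domain `C₀^∞((-1,1) \ {0})`. -/
def singularOp (c : ℝ) : L2 𝕜 →ₗ.[𝕜] L2 𝕜 where
  domain := LinearMap.range (testToL2 𝕜)
  toFun := diffExprL2 𝕜 c ∘ₗ
    (LinearEquiv.ofInjective (testToL2 𝕜) (testToL2_injective 𝕜)).symm.toLinearMap

theorem testToL2_mem_domain (c : ℝ) (f : 𝓓(puncturedInterval, 𝕜)) :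
    testToL2 𝕜 f ∈ (singularOp 𝕜 c).domain :=
  ⟨f, rfl⟩

theorem singularOp_apply (c : ℝ) (f : 𝓓(puncturedInterval, 𝕜)) :
    singularOp 𝕜 c ⟨testToL2 𝕜 f, testToL2_mem_domain c f⟩ = diffExprL2 𝕜 c f :=
  congrArg (diffExprL2 𝕜 c)
    ((LinearEquiv.ofInjective (testToL2 𝕜) (testToL2_injective 𝕜)).symm_apply_apply f)

end

/-- A strongly continuous (`C⁰`) one-parameter semigroup of bounded linear operators. -/
structure IsC0Semigroup {𝕜 X : Type*} [RCLike 𝕜] [NormedAddCommGroup X] [NormedSpace 𝕜 X]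
    (T : ℝ≥0 → X →L[𝕜] X) : Prop where
  map_zero : T 0 = ContinuousLinearMap.id 𝕜 X
  map_add : ∀ s t : ℝ≥0, T (s + t) = (T s).comp (T t)
  continuous_orbit : ∀ x : X, Continuous fun t : ℝ≥0 => T t x

/-- `A` is the infinitesimal generator of `T`: its domain is the set of all `x` for which
`(T h x - x) / h` converges as `h → 0⁺`, and `A x` is the limit. -/
def IsGenerator {𝕜 X : Type*} [RCLike 𝕜] [NormedAddCommGroup X] [NormedSpace 𝕜 X]
    (T : ℝ≥0 → X →L[𝕜] X) (A : X →ₗ.[𝕜] X) : Prop :=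
  ∀ x y : X, (x, y) ∈ A.graph ↔
    Tendsto (fun h : ℝ≥0 => (((h : ℝ) : 𝕜))⁻¹ • (T h x - x)) (𝓝[>] 0) (𝓝 y)

/-- `A` generates a `C⁰`-semigroup. -/
def GeneratesC0Semigroup {𝕜 X : Type*} [RCLike 𝕜] [NormedAddCommGroup X] [NormedSpace 𝕜 X]
    (A : X →ₗ.[𝕜] X) : Prop :=
  ∃ T : ℝ≥0 → X →L[𝕜] X, IsC0Semigroup T ∧ IsGenerator T A

end InverseSquare

end

/-! A self-adjoint generator of a C⁰-semigroup is bounded above: `IsGenerator.re_inner_le` gives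
Re⟨x, Ax⟩ ≤ ‖T 1‖ ‖x‖². Below the Hardy constant -1/4 the operator violates every such bound on test
functions. With x = e^s and f(x) = √x φ(s + a), the quadratic form becomes ∫ φ (φ'' + (-1/4 - c) φ)
ds, which does not depend on a, whereas ‖f‖² is proportional to e^(-2a) (`exists_test_energy`).
Since -1/4 - c > 0, a wide bump φ makes the form positive (`exists_energy_pos`); letting a → ∞ gives
a contradiction. -/

namespace InverseSquare

/-! ### Semigroups with self-adjoint generator -/

section Semigroup

variable {𝕜 X : Type*} [RCLike 𝕜] [NormedAddCommGroup X]

section Normed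

variable [NormedSpace 𝕜 X] [NormedSpace ℝ X] [IsScalarTower ℝ 𝕜 X]
  {T : ℝ≥0 → X →L[𝕜] X} {A : X →ₗ.[𝕜] X}

/-- The orbit of a point of the domain of the generator is differentiable from the right. -/
theorem IsGenerator.hasDerivWithinAt_orbit (hT : IsC0Semigroup T) (hA : IsGenerator T A)
    {x y : X} (hxy : (x, y) ∈ A.graph) {t : ℝ} (ht : 0 ≤ t) :
    HasDerivWithinAt (fun s : ℝ => T s.toNNReal x) (T t.toNNReal y) (Set.Ioi t) t := by
  rw [hasDerivWithinAt_iff_tendsto_slope' (by simp)]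
  have h1 : Tendsto (fun s : ℝ => (s - t).toNNReal) (𝓝[>] t) (𝓝[>] 0) := by
    refine tendsto_nhdsWithin_iff.2 ⟨?_, ?_⟩
    · have h : Tendsto (fun s : ℝ => (s - t).toNNReal) (𝓝 t) (𝓝 (t - t).toNNReal) :=
        (continuous_real_toNNReal.comp (continuous_id.sub continuous_const)).tendsto t
      simpa using h.mono_left nhdsWithin_le_nhds
    · filter_upwards [self_mem_nhdsWithin] with s hs
      exact Real.toNNReal_pos.2 (sub_pos.2 hs)
  have h2 := ((T t.toNNReal).continuous.tendsto y).comp (((hA x y).1 hxy).comp h1)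
  refine h2.congr' ?_
  filter_upwards [self_mem_nhdsWithin] with s hs
  have hst : 0 ≤ s - t := (sub_pos.2 hs).le
  have h3 : s.toNNReal = t.toNNReal + (s - t).toNNReal := by
    rw [← Real.toNNReal_add ht hst, add_sub_cancel]
  simp only [Function.comp_apply, slope_def_module, h3, hT.map_add, Real.coe_toNNReal _ hst,
    map_smul, map_sub (T t.toNNReal), ContinuousLinearMap.comp_apply]
  rw [← RCLike.ofReal_inv, RCLike.ofReal_alg, smul_assoc, one_smul]

/-- The orbit of a point of the domain of the generator agrees on `[0, ∞)` with a differentiable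
curve. -/
theorem IsGenerator.exists_hasDerivAt_orbit [CompleteSpace X] (hT : IsC0Semigroup T)
    (hA : IsGenerator T A) {x y : X} (hxy : (x, y) ∈ A.graph) :
    ∃ u : ℝ → X, (∀ t, HasDerivAt u (T t.toNNReal y) t) ∧
      ∀ t, 0 ≤ t → u t = T t.toNNReal x := by
  have hc : ∀ z : X, Continuous fun s : ℝ => T s.toNNReal z := fun z =>
    (hT.continuous_orbit z).comp continuous_real_toNNReal
  -- For s < 0 the integrand is T 0 y, so the curve extends past 0 and has a two-sided derivative
  -- there too.
  refine ⟨fun t => x + ∫ s in (0 : ℝ)..t, T s.toNNReal y, fun t => ?_, fun t ht => ?_⟩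
  · exact ((hc y).integral_hasStrictDerivAt 0 t).hasDerivAt.const_add x
  · have h := intervalIntegral.integral_eq_sub_of_hasDeriv_right (a := 0) (b := t)
      (hc x).continuousOn
      (fun s hs => hA.hasDerivWithinAt_orbit hT hxy (by simpa [ht] using hs.1.le))
      ((hc y).intervalIntegrable _ _)
    simp [h, hT.map_zero]

omit [NormedSpace ℝ X] [IsScalarTower ℝ 𝕜 X] in
/-- The generator commutes with its semigroup. -/
theorem IsGenerator.map_mem_graph (hT : IsC0Semigroup T) (hA : IsGenerator T A)
    {x y : X} (hxy : (x, y) ∈ A.graph) (t : ℝ≥0) : (T t x, T t y) ∈ A.graph := by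
  refine (hA _ _).2 (((T t).continuous.tendsto y).comp ((hA x y).1 hxy) |>.congr fun h => ?_)
  simp only [Function.comp_apply, map_smul, map_sub]
  rw [← ContinuousLinearMap.comp_apply, ← ContinuousLinearMap.comp_apply, ← hT.map_add,
    ← hT.map_add, add_comm]

end Normed

variable [InnerProductSpace 𝕜 X] [NormedSpace ℝ X] [IsScalarTower ℝ 𝕜 X] [CompleteSpace X]
  {T : ℝ≥0 → X →L[𝕜] X} {A : X →ₗ.[𝕜] X}

omit [NormedSpace ℝ X] [IsScalarTower ℝ 𝕜 X] in
theorem inner_graph_of_isSelfAdjoint (hs : IsSelfAdjoint A) {x y x' y' : X}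
    (h : (x, y) ∈ A.graph) (h' : (x', y') ∈ A.graph) : inner 𝕜 y x' = inner 𝕜 x y' := by
  obtain ⟨a, rfl, rfl⟩ := A.mem_graph_iff.1 h
  obtain ⟨b, rfl, rfl⟩ := A.mem_graph_iff.1 h'
  have key := LinearPMap.adjoint_isFormalAdjoint hs.dense_domain
  rw [LinearPMap.isSelfAdjoint_def.1 hs] at key
  exact key a b

/-- A semigroup with self-adjoint generator is symmetric. -/
theorem IsGenerator.inner_map_eq (hT : IsC0Semigroup T) (hA : IsGenerator T A)
    (hs : IsSelfAdjoint A) (t : ℝ≥0) (x x' : X) : inner 𝕜 (T t x) x' = inner 𝕜 x (T t x') := by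
  have key : ∀ x ∈ A.domain, ∀ x' ∈ A.domain, inner 𝕜 (T t x) x' = inner 𝕜 x (T t x') := by
    intro x hx x' hx'
    have hg := A.mem_graph ⟨x, hx⟩
    have hg' := A.mem_graph ⟨x', hx'⟩
    obtain ⟨u, hu, hu'⟩ := hA.exists_hasDerivAt_orbit hT hg
    obtain ⟨v, hv, hv'⟩ := hA.exists_hasDerivAt_orbit hT hg'
    -- Moving time from one argument to the other: the derivative of ⟨T(t-s)x, T(s)x'⟩ vanishes
    -- because A is symmetric, and the ends s = 0, t give the claim.
    have hd : ∀ s : ℝ, HasDerivAt (fun s => inner 𝕜 (u (t - s)) (v s))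
        (inner 𝕜 (u (t - s)) (T s.toNNReal (A ⟨x', hx'⟩)) +
          inner 𝕜 (-T (t - s).toNNReal (A ⟨x, hx⟩)) (v s)) s := fun s =>
      ((hu (t - s)).comp_const_sub _ _).inner 𝕜 (hv s)
    have hc := constant_of_has_deriv_right_zero (a := 0) (b := t)
      (f := fun s => inner 𝕜 (u (t - s)) (v s))
      (fun s _ => (hd s).continuousAt.continuousWithinAt) (fun s hs' => by
        refine (hd s).hasDerivWithinAt.congr_deriv ?_
        rw [hu' _ (sub_nonneg.2 hs'.2.le), hv' _ hs'.1, inner_neg_left,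
          inner_graph_of_isSelfAdjoint hs (hA.map_mem_graph hT hg (t - s).toNNReal)
            (hA.map_mem_graph hT hg' s.toNNReal), add_neg_cancel]) t ⟨t.2, le_rfl⟩
    simpa [hu' 0, hv' 0, hu' t, hv' t, hT.map_zero] using hc.symm
  have hd := hs.dense_domain
  have step : ∀ x ∈ A.domain, inner 𝕜 (T t x) x' = inner 𝕜 x (T t x') := fun x hx =>
    congrFun (Continuous.ext_on hd (by fun_prop) (by fun_prop) fun x' hx' => key x hx x' hx') x'
  exact congrFun (Continuous.ext_on hd (f := fun x => inner 𝕜 (T t x) x')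
    (g := fun x => inner 𝕜 x (T t x')) (by fun_prop) (by fun_prop) step) x

/-- Symmetry gives ‖T t x‖² = ⟨x, T(2t)x⟩ ≤ ‖T(2t)x‖ for a unit vector; this is iterated n times. -/
theorem IsGenerator.norm_pow_le (hT : IsC0Semigroup T) (hA : IsGenerator T A)
    (hs : IsSelfAdjoint A) {x : X} (hx : ‖x‖ = 1) (n : ℕ) (t : ℝ≥0) :
    ‖T t x‖ ^ 2 ^ n ≤ ‖T (2 ^ n * t) x‖ := by
  induction n generalizing t with
  | zero => simp
  | succ n ih =>
    have h : ‖T t x‖ ^ 2 ≤ ‖T (2 * t) x‖ := by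
      rw [← inner_self_eq_norm_sq (𝕜 := 𝕜), hA.inner_map_eq hT hs, ← inner_conj_symm,
        ← ContinuousLinearMap.comp_apply, ← hT.map_add, ← two_mul, RCLike.conj_re]
      exact (re_inner_le_norm _ _).trans_eq (by rw [hx, mul_one])
    calc ‖T t x‖ ^ 2 ^ (n + 1) = (‖T t x‖ ^ 2) ^ 2 ^ n := by rw [← pow_mul, ← pow_succ']
      _ ≤ ‖T (2 * t) x‖ ^ 2 ^ n := by gcongr
      _ ≤ _ := ih _
      _ = _ := by rw [pow_succ, mul_assoc]

/-- A self-adjoint generator of a `C⁰`-semigroup is bounded above. -/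
theorem IsGenerator.re_inner_le (hT : IsC0Semigroup T) (hA : IsGenerator T A)
    (hs : IsSelfAdjoint A) {x y : X} (hxy : (x, y) ∈ A.graph) :
    RCLike.re (inner 𝕜 x y) ≤ ‖T 1‖ * ‖x‖ ^ 2 := by
  have unit : ∀ x y : X, (x, y) ∈ A.graph → ‖x‖ = 1 → RCLike.re (inner 𝕜 x y) ≤ ‖T 1‖ := by
    intro x y hxy hx
    -- Times 2⁻ⁿ are chosen so that n doublings end at time 1.
    have h1 : Tendsto (fun n : ℕ => ((2 : ℝ≥0) ^ n)⁻¹) atTop (𝓝[>] 0) := by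
      refine tendsto_nhdsWithin_iff.2 ⟨?_, .of_forall fun n => by simp⟩
      simpa using tendsto_pow_atTop_nhds_zero_of_lt_one (r := (2 : ℝ≥0)⁻¹) (by simp)
        (by rw [← NNReal.coe_lt_coe]; norm_num)
    have h2 := ((hA x y).1 hxy).comp h1
    have h3 : Tendsto (fun z : X => RCLike.re (inner 𝕜 x z)) (𝓝 y)
        (𝓝 (RCLike.re (inner 𝕜 x y))) :=
      (RCLike.continuous_re.comp (continuous_const.inner continuous_id)).tendsto y
    refine le_of_tendsto (h3.comp h2) (.of_forall fun n => ?_)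
    set p : ℝ := ‖T ((2 ^ n)⁻¹) x‖ with hp
    have h4 : p ^ 2 ^ n ≤ ‖T 1‖ := by
      refine (hA.norm_pow_le hT hs hx n _).trans ?_
      rw [mul_inv_cancel₀ (by positivity)]
      simpa [hx] using (T 1).le_opNorm x
    -- Bernoulli turns pᴺ ≤ ‖T 1‖, N = 2ⁿ, into N(p - 1) ≤ ‖T 1‖ - 1, which bounds the difference
    -- quotient.
    have h5 : 1 + ((2 ^ n : ℕ) : ℝ) * (p - 1) ≤ (1 + (p - 1)) ^ 2 ^ n :=
      one_add_mul_le_pow (by linarith [norm_nonneg (T ((2 ^ n)⁻¹) x)]) _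
    have h6 : RCLike.re (inner 𝕜 x (T ((2 ^ n)⁻¹) x)) ≤ p :=
      (re_inner_le_norm _ _).trans_eq (by rw [hx, one_mul])
    have h7 : RCLike.re (inner 𝕜 x x : 𝕜) = 1 := by rw [inner_self_eq_norm_sq, hx, one_pow]
    have h8 : RCLike.re (inner 𝕜 x (((((2 ^ n)⁻¹ : ℝ≥0) : ℝ) : 𝕜)⁻¹ • (T ((2 ^ n)⁻¹) x - x)))
        = 2 ^ n * (RCLike.re (inner 𝕜 x (T ((2 ^ n)⁻¹) x)) - 1) := by
      rw [← RCLike.ofReal_inv, inner_smul_right, RCLike.re_ofReal_mul, inner_sub_right, map_sub,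
        h7]
      simp
    simp only [Function.comp_apply, h8]
    have h9 : (2 : ℝ) ^ n * (RCLike.re (inner 𝕜 x (T ((2 ^ n)⁻¹) x)) - 1) ≤ 2 ^ n * (p - 1) := by
      gcongr
    push_cast at h5
    rw [add_sub_cancel] at h5
    linarith
  rcases eq_or_ne x 0 with rfl | hx
  · simp
  have hx' : (0 : ℝ) < ‖x‖ := norm_pos_iff.2 hx
  have h := unit (((‖x‖⁻¹ : ℝ) : 𝕜) • x) (((‖x‖⁻¹ : ℝ) : 𝕜) • y)
    (A.graph.smul_mem _ hxy) (by simp [norm_smul, hx'.ne'])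
  rw [inner_smul_left, inner_smul_right, RCLike.conj_ofReal, RCLike.re_ofReal_mul,
    RCLike.re_ofReal_mul, ← mul_assoc, ← mul_inv, ← sq, inv_mul_le_iff₀ (by positivity)] at h
  linarith

end Semigroup

end InverseSquare

/-! ### Logarithmic profiles and the substitution x = e^s -/

namespace InverseSquare

/-- The function `√x φ(log x + a)`, which vanishes on `(-∞, 0]`. -/
noncomputable def logProfile (φ : ℝ → ℝ) (a x : ℝ) : ℝ := √x * φ (Real.log x + a)

section Profile

variable {φ : ℝ → ℝ} {a R : ℝ}

theorem logProfile_eq_zero (hR : ∀ s, R < |s| → φ s = 0) {x : ℝ}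
    (hx : x ∉ Set.Icc (Real.exp (-a - R)) (Real.exp (-a + R))) : logProfile φ a x = 0 := by
  rcases le_or_gt x 0 with h | h
  · simp [logProfile, Real.sqrt_eq_zero_of_nonpos h]
  · rw [logProfile, hR, mul_zero]
    rw [Set.mem_Icc, not_and_or, not_le, not_le, ← Real.log_lt_iff_lt_exp h,
      ← Real.lt_log_iff_exp_lt h] at hx
    rcases hx with hx | hx
    · exact lt_abs.2 (.inr (by linarith))
    · exact lt_abs.2 (.inl (by linarith))

theorem contDiff_logProfile {n : ℕ∞} (hφ : ContDiff ℝ n φ) (hR : ∀ s, R < |s| → φ s = 0) :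
    ContDiff ℝ n (logProfile φ a) := by
  rw [contDiff_iff_contDiffAt]
  intro x
  rcases lt_or_ge 0 x with h | h
  · exact (Real.contDiffAt_sqrt h.ne').mul
      (hφ.contDiffAt.comp x ((Real.contDiffAt_log.2 h.ne').add contDiffAt_const))
  · refine (contDiffAt_const (c := (0 : ℝ))).congr_of_eventuallyEq ?_
    filter_upwards [Iio_mem_nhds (h.trans_lt (Real.exp_pos (-a - R)))] with y hy
    exact logProfile_eq_zero hR fun h' => (hy.trans_le h'.1).false

/-- In s = log x, x²∂ₓₓ is ∂ₛ² - ∂ₛ; conjugation by √x = e^(s/2) removes the first-order term and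
leaves ∂ₛ² - 1/4. -/
theorem deriv_deriv_logProfile (hφ : ContDiff ℝ 2 φ) {x : ℝ} (hx : 0 < x) :
    deriv (deriv (logProfile φ a)) x =
      (x * √x)⁻¹ * (deriv (deriv φ) (Real.log x + a) - φ (Real.log x + a) / 4) := by
  have hφ' : ContDiff ℝ 1 (deriv φ) := ((contDiff_succ_iff_deriv (n := 1)).1 hφ).2.2
  have hlog : ∀ y : ℝ, 0 < y → HasDerivAt (fun y => Real.log y + a) y⁻¹ y := fun y hy =>
    (Real.hasDerivAt_log hy.ne').add_const a
  have hd : ∀ y : ℝ, 0 < y → HasDerivAt (logProfile φ a)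
      ((√y)⁻¹ * (deriv φ (Real.log y + a) + φ (Real.log y + a) / 2)) y := by
    intro y hy
    have h := (Real.hasDerivAt_sqrt hy.ne').mul
      (((hφ.differentiable (by norm_num)) (Real.log y + a)).hasDerivAt.comp y (hlog y hy))
    refine h.congr_deriv ?_
    have hs := Real.sqrt_pos.2 hy
    have hy2 := Real.sq_sqrt hy.le
    -- Writing y as (√y)² makes the identity rational in √y.
    rw [← hy2, Real.sqrt_sq hs.le]
    simp only [Function.comp_apply]
    field_simp
    ring
  have he : deriv (logProfile φ a) =ᶠ[𝓝 x]
      fun y => (√y)⁻¹ * (deriv φ (Real.log y + a) + φ (Real.log y + a) / 2) := by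
    filter_upwards [Ioi_mem_nhds hx] with y hy using (hd y hy).deriv
  rw [he.deriv_eq]
  have h := ((Real.hasDerivAt_sqrt hx.ne').inv (Real.sqrt_pos.2 hx).ne').mul
    ((((hφ'.differentiable (by norm_num)) (Real.log x + a)).hasDerivAt.comp x (hlog x hx)).add
      ((((hφ.differentiable (by norm_num)) (Real.log x + a)).hasDerivAt.comp x
        (hlog x hx)).div_const 2))
  refine h.deriv.trans ?_
  have hs := Real.sqrt_pos.2 hx
  have hx2 := Real.sq_sqrt hx.le
  simp only [Function.comp_apply, Pi.add_apply, Pi.inv_apply]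
  rw [← hx2, Real.sqrt_sq hs.le]
  field_simp
  ring

/-- The factor x⁻¹ cancels the Jacobian e^s, leaving an integrand that depends on s + a only. -/
theorem diffExpr_mul_logProfile (c : ℝ) (hφ : ContDiff ℝ 2 φ) {x : ℝ} (hx : 0 < x) :
    logProfile φ a x * diffExpr c (logProfile φ a) x =
      x⁻¹ * (φ (Real.log x + a) *
        (deriv (deriv φ) (Real.log x + a) + (-1 / 4 - c) * φ (Real.log x + a))) := by
  rw [diffExpr, deriv_deriv_logProfile hφ hx, logProfile, smul_eq_mul]
  have hs := Real.sqrt_pos.2 hx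
  have hx2 := Real.sq_sqrt hx.le
  rw [← hx2, Real.sqrt_sq hs.le]
  field_simp
  ring

theorem setIntegral_Ioo_eq_integral_exp {F : ℝ → ℝ} (hF : ∀ x ∉ Set.Ioo (0 : ℝ) 1, F x = 0) :
    ∫ x in Set.Ioo (-1 : ℝ) 1, F x = ∫ s, Real.exp s * F (Real.exp s) := by
  have h := integral_image_eq_integral_abs_deriv_smul (s := Set.univ) MeasurableSet.univ
    (fun x _ => (Real.hasDerivAt_exp x).hasDerivWithinAt) Real.exp_injective.injOn F
  rw [Set.image_univ, Real.range_exp] at h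
  have h1 : ∀ x ∉ Set.Ioo (-1 : ℝ) 1, F x = 0 := fun x hx => hF x fun h' =>
    hx ⟨by linarith [h'.1], h'.2⟩
  have h2 : ∀ x ∉ Set.Ioi (0 : ℝ), F x = 0 := fun x hx => hF x fun h' => hx h'.1
  rw [setIntegral_eq_integral_of_forall_compl_eq_zero h1,
    ← setIntegral_eq_integral_of_forall_compl_eq_zero h2, h]
  simp [Real.abs_exp]

end Profile

/-! ### Real test functions in 𝕜-valued L², and their energies -/

section Coercion

variable {𝕜 : Type*} [RCLike 𝕜]

theorem deriv_rclike_ofReal_comp {g : ℝ → ℝ} (hg : Differentiable ℝ g) :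
    deriv (fun x => (g x : 𝕜)) = fun x => ((deriv g x : ℝ) : 𝕜) := by
  funext x
  exact ((RCLike.ofRealCLM (K := 𝕜)).hasFDerivAt.comp_hasDerivAt x (hg x).hasDerivAt).deriv

theorem diffExpr_ofReal (c : ℝ) {g : ℝ → ℝ} (hg : ContDiff ℝ 2 g) (x : ℝ) :
    diffExpr c (fun x => (g x : 𝕜)) x = ((diffExpr c g x : ℝ) : 𝕜) := by
  have hg' : ContDiff ℝ 1 (deriv g) := ((contDiff_succ_iff_deriv (n := 1)).1 hg).2.2
  rw [diffExpr, diffExpr, deriv_rclike_ofReal_comp (hg.differentiable (by norm_num)),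
    deriv_rclike_ofReal_comp (hg'.differentiable (by norm_num)), RCLike.real_smul_eq_coe_mul]
  simp

/-- A real test function as a `𝕜`-valued test function. -/
noncomputable def ofRealTest (𝕜 : Type*) [RCLike 𝕜] (g : 𝓓(puncturedInterval, ℝ)) :
    𝓓(puncturedInterval, 𝕜) where
  toFun x := (g x : 𝕜)
  contDiff' := (RCLike.ofRealCLM (K := 𝕜)).contDiff.comp g.contDiff
  hasCompactSupport' := g.hasCompactSupport.comp_left (g := ((↑) : ℝ → 𝕜)) (by simp)
  tsupport_subset' := by
    refine (closure_mono fun x (hx : (g x : 𝕜) ≠ 0) => ?_).trans g.tsupport_subset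
    exact fun h => hx (by simp [h])

theorem inner_ofRealTest (c : ℝ) (g : 𝓓(puncturedInterval, ℝ)) :
    RCLike.re (inner 𝕜 (testToL2 𝕜 (ofRealTest 𝕜 g)) (diffExprL2 𝕜 c (ofRealTest 𝕜 g))) =
      ∫ x in Set.Ioo (-1 : ℝ) 1, g x * diffExpr c g x := by
  rw [L2.inner_def]
  have h : ∫ x in Set.Ioo (-1 : ℝ) 1, inner 𝕜 (testToL2 𝕜 (ofRealTest 𝕜 g) x)
      (diffExprL2 𝕜 c (ofRealTest 𝕜 g) x) =
      ∫ x in Set.Ioo (-1 : ℝ) 1, ((g x * diffExpr c g x : ℝ) : 𝕜) := by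
    refine integral_congr_ae ?_
    filter_upwards [(memLp_test (ofRealTest 𝕜 g)).coeFn_toLp,
      (memLp_diffExpr c (ofRealTest 𝕜 g)).coeFn_toLp] with x h1 h2
    rw [show testToL2 𝕜 (ofRealTest 𝕜 g) x = (g x : 𝕜) from h1,
      show diffExprL2 𝕜 c (ofRealTest 𝕜 g) x = _ from h2,
      show diffExpr c (ofRealTest 𝕜 g) x = _ from diffExpr_ofReal c (contDiff_test g) x]
    simp [mul_comm]
  rw [h, integral_ofReal, RCLike.ofReal_re]

theorem norm_sq_ofRealTest (g : 𝓓(puncturedInterval, ℝ)) :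
    ‖testToL2 𝕜 (ofRealTest 𝕜 g)‖ ^ 2 = ∫ x in Set.Ioo (-1 : ℝ) 1, g x ^ 2 := by
  rw [← inner_self_eq_norm_sq (𝕜 := 𝕜), L2.inner_def]
  have h : ∫ x in Set.Ioo (-1 : ℝ) 1, inner 𝕜 (testToL2 𝕜 (ofRealTest 𝕜 g) x)
      (testToL2 𝕜 (ofRealTest 𝕜 g) x) =
      ∫ x in Set.Ioo (-1 : ℝ) 1, ((g x ^ 2 : ℝ) : 𝕜) := by
    refine integral_congr_ae ?_
    filter_upwards [(memLp_test (ofRealTest 𝕜 g)).coeFn_toLp] with x h1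
    rw [show testToL2 𝕜 (ofRealTest 𝕜 g) x = (g x : 𝕜) from h1]
    simp only [RCLike.inner_apply, RCLike.conj_ofReal, sq, RCLike.ofReal_mul]
  rw [h, integral_ofReal, RCLike.ofReal_re]

/-- The rescalings of a logarithmic profile keep the energy and have norms tending to zero. -/
theorem exists_test_energy (c : ℝ) {φ : ℝ → ℝ} {a R : ℝ} (hφ : ContDiff ℝ (⊤ : ℕ∞) φ)
    (hR : ∀ s, R < |s| → φ s = 0) (ha : R < a) :
    ∃ f : 𝓓(puncturedInterval, 𝕜),
      RCLike.re (inner 𝕜 (testToL2 𝕜 f) (diffExprL2 𝕜 c f)) =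
        ∫ s, φ s * (deriv (deriv φ) s + (-1 / 4 - c) * φ s) ∧
      ‖testToL2 𝕜 f‖ ^ 2 = Real.exp (-2 * a) * ∫ s, Real.exp (2 * s) * φ s ^ 2 := by
  have hφ2 : ContDiff ℝ 2 φ := hφ.of_le (WithTop.coe_le_coe.2 le_top)
  -- R < a is what keeps the support inside (0,1).
  have hsub : Set.Icc (Real.exp (-a - R)) (Real.exp (-a + R)) ⊆ Set.Ioo 0 1 := fun x hx =>
    ⟨(Real.exp_pos _).trans_le hx.1, hx.2.trans_lt
      ((Real.exp_lt_exp.2 (by linarith)).trans_eq Real.exp_zero)⟩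
  have h0 : ∀ x ∉ Set.Ioo (0 : ℝ) 1, logProfile φ a x = 0 := fun x hx =>
    logProfile_eq_zero hR fun h => hx (hsub h)
  let g : 𝓓(puncturedInterval, ℝ) :=
    { toFun := logProfile φ a
      contDiff' := contDiff_logProfile hφ hR
      hasCompactSupport' := HasCompactSupport.intro isCompact_Icc fun x hx =>
        logProfile_eq_zero hR hx
      tsupport_subset' := by
        refine (closure_minimal (fun x hx => ?_) isClosed_Icc).trans fun x hx =>
          ⟨⟨by linarith [(hsub hx).1], (hsub hx).2⟩, (hsub hx).1.ne'⟩
        by_contra h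
        exact hx (logProfile_eq_zero hR h) }
  have hg : ⇑g = logProfile φ a := rfl
  refine ⟨ofRealTest 𝕜 g, ?_, ?_⟩
  · rw [inner_ofRealTest, hg, setIntegral_Ioo_eq_integral_exp fun x hx => by rw [h0 x hx, zero_mul],
      ← integral_add_right_eq_self
        (fun s => φ s * (deriv (deriv φ) s + (-1 / 4 - c) * φ s)) a]
    refine integral_congr_ae (.of_forall fun s => ?_)
    simp only [diffExpr_mul_logProfile c hφ2 (Real.exp_pos s), Real.log_exp]
    rw [mul_inv_cancel_left₀ (Real.exp_pos s).ne']
  -- The Jacobian and the square of √x each give e^s; shifting s by a extracts e^(-2a).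
  · rw [norm_sq_ofRealTest, hg, setIntegral_Ioo_eq_integral_exp fun x hx => by simp [h0 x hx],
      ← integral_add_right_eq_self (fun s => Real.exp (2 * s) * φ s ^ 2) a, ← integral_const_mul]
    refine integral_congr_ae (.of_forall fun s => ?_)
    simp only [logProfile, Real.log_exp, mul_pow, Real.sq_sqrt (Real.exp_pos s).le, ← mul_assoc,
      ← Real.exp_add]
    ring_nf

end Coercion

/-- Wide bumps have positive energy. -/
theorem exists_energy_pos {δ : ℝ} (hδ : 0 < δ) :
    ∃ (φ : ℝ → ℝ) (R : ℝ), ContDiff ℝ (⊤ : ℕ∞) φ ∧ (∀ s, R < |s| → φ s = 0) ∧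
      0 < ∫ s, φ s * (deriv (deriv φ) s + δ * φ s) := by
  let b : ContDiffBump (0 : ℝ) := ⟨1, 2, one_pos, one_lt_two⟩
  have hb : ContDiff ℝ (⊤ : ℕ∞) b := b.contDiff
  have hb2 : ContDiff ℝ 2 b := b.contDiff
  have hb1 : ContDiff ℝ 1 (deriv b) := ((contDiff_succ_iff_deriv (n := 1)).1 hb2).2.2
  have hc2 : Continuous (deriv (deriv b)) := hb1.continuous_deriv le_rfl
  have hs : HasCompactSupport b := b.hasCompactSupport
  have hi1 : Integrable fun s => b s * deriv (deriv b) s :=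
    (b.continuous.mul hc2).integrable_of_hasCompactSupport hs.mul_right
  have hi2 : Integrable fun s => b s * b s :=
    (b.continuous.mul b.continuous).integrable_of_hasCompactSupport hs.mul_right
  have hpos : 0 < ∫ s, b s * b s := by
    refine (b.continuous.mul b.continuous).integral_pos_of_hasCompactSupport_nonneg_nonzero
      hs.mul_right (fun s => mul_self_nonneg _) (x := 0) ?_
    have h : b 0 = 1 := b.one_of_mem_closedBall (by simp [b])
    simp [h]
  set I := ∫ s, b s * deriv (deriv b) s
  set J := ∫ s, b s * b s
  -- For b(εs) the energy is ε⁻¹(ε²I + δJ); since J > 0, the second term wins for small ε, whatever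
  -- the sign of I.
  obtain ⟨ε, hε, hεI⟩ : ∃ ε : ℝ, 0 < ε ∧ 0 < ε ^ 2 * I + δ * J := by
    have h : Tendsto (fun ε : ℝ => ε ^ 2 * I + δ * J) (𝓝[>] 0) (𝓝 (0 ^ 2 * I + δ * J)) :=
      Tendsto.mono_left (Continuous.tendsto (by fun_prop) 0) nhdsWithin_le_nhds
    obtain ⟨ε, h1, h2⟩ := ((h.eventually_const_lt (u := 0) (by simp; positivity)).and
      self_mem_nhdsWithin).exists
    exact ⟨ε, h2, h1⟩
  have hd : ∀ g : ℝ → ℝ, deriv (fun s => g (ε * s)) = fun s => ε * deriv g (ε * s) := fun g => by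
    funext s
    exact deriv_comp_mul_left ε g s
  refine ⟨fun s => b (ε * s), 2 / ε, hb.comp (contDiff_const.mul contDiff_id), fun s hs => ?_, ?_⟩
  · refine b.zero_of_le_dist ?_
    rw [Real.dist_0_eq_abs, abs_mul, abs_of_pos hε]
    rw [div_lt_iff₀ hε] at hs
    change 2 ≤ _
    linarith
  · have h : ∀ s, b (ε * s) * (deriv (deriv fun s => b (ε * s)) s + δ * b (ε * s)) =
        (fun u => ε ^ 2 * (b u * deriv (deriv b) u) + δ * (b u * b u)) (ε * s) := fun s => by
      rw [hd, deriv_const_mul_field, hd]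
      ring
    simp only [h]
    rw [Measure.integral_comp_mul_left (fun u => ε ^ 2 * (b u * deriv (deriv b) u) +
        δ * (b u * b u)), integral_add (hi1.const_mul _) (hi2.const_mul _), integral_const_mul,
      integral_const_mul, smul_eq_mul]
    positivity

end InverseSquare

/-! ### Contradiction as the profiles concentrate at 0 -/

theorem mainTheorem11 {𝕜 : Type*} [RCLike 𝕜] (c : ℝ) (hc : c < -1 / 4) :
    ¬ ∃ A : InverseSquare.L2 𝕜 →ₗ.[𝕜] InverseSquare.L2 𝕜,
      InverseSquare.singularOp 𝕜 c ≤ A ∧ IsSelfAdjoint A ∧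
        InverseSquare.GeneratesC0Semigroup A := by
  rintro ⟨A, hle, hs, T, hT, hA⟩
  obtain ⟨φ, R, hφ, hR, hpos⟩ := InverseSquare.exists_energy_pos (δ := -1 / 4 - c) (by linarith)
  have hlim : Tendsto (fun a : ℝ => ‖T 1‖ * (Real.exp (-2 * a) *
      ∫ s, Real.exp (2 * s) * φ s ^ 2)) atTop (𝓝 (‖T 1‖ * (0 *
      ∫ s, Real.exp (2 * s) * φ s ^ 2))) := by
    refine ((Real.tendsto_exp_atBot.comp ?_).mul_const _).const_mul _
    exact tendsto_id.const_mul_atTop_of_neg (by norm_num)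
  -- The energy, fixed and positive, would be at most ‖T 1‖ ‖f‖², which tends to 0 as a → ∞.
  refine hpos.not_ge (le_trans (ge_of_tendsto hlim ?_) (by simp))
  filter_upwards [eventually_gt_atTop R] with a ha
  obtain ⟨f, h1, h2⟩ := InverseSquare.exists_test_energy (𝕜 := 𝕜) c hφ hR ha
  rw [← h1, ← h2]
  refine hA.re_inner_le hT hs ?_
  have h := LinearPMap.le_graph_of_le hle ((InverseSquare.singularOp 𝕜 c).mem_graph
    ⟨_, InverseSquare.testToL2_mem_domain c f⟩)
  rwa [InverseSquare.singularOp_apply] at h
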